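/- Let $\lambda\ge 0$, $\gamma>0$, and let $\sigma^\gamma:\mathbb R\to[-1,1]$ be smooth, strictly monotonic and $\gamma$-Lipschitz with $\sigma^\gamma(0)=0$. For integers $D\ge 1$ and $K\ge 0$ let $$\mathcal H^{\text{2-net}}:=\Big\{x\mapsto\sum_{i=1}^K w_i\,\sigma^\gamma(v_i\cdot x)\ \Big|\ \|w\|_1\le 1,\ \|v_i\|_1\le 1\ (i=1,\dots,K)\Big\}$$ be the class of two-layer feed-forward networks on $X=\mathbb R^D$ with $K$ hidden units. Let $\phi^\lambda:\mathbb R\times\{0,1\}\to\mathbb R$ be a loss that is $\lambda$-Lipschitz in its first argument. Let $\mathcal D$ be a probability distribution on $X\times\{0,1\}$ with $\|x\|_2\le B$ almost surely, and let $S_m=\{(x_i,y_i)\}_{i=1}^m$ be an i.i.d. sample from $\mathcal D$ of size $m\ge 1$. For $M\in\mathbb R^{D\times D}$ put $$\mathrm{err}(M,\mathcal D):=\inf_{h\in\mathcal H^{\text{2-net}}}\mathbb E_{(x,y)\sim\mathcal D}\big[\phi^\lambda(h(Mx),y)\big],\qquad \mathrm{err}(M,S_m):=\inf_{h\in\mathcal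 H^{\text{2-net}}}\frac1m\sum_{i=1}^m\phi^\lambda(h(Mx_i),y_i).$$ Let $\mathcal M\subseteq\mathbb R^{D\times D}$ be any class of weighting metrics and $d\ge 1$ a real number with $\sup_{M\in\mathcal M}\|M^{\mathsf T}M\|_F^2\le d$ (the condition $d\ge1$ is automatic for a non-empty class of metrics normalized by $\sigma_{\max}(M)=1$). For every real $\kappa$ there is a constant $C>0$, depending only on $\kappa$, such that whenever the dependence of the loss on the label at prediction $0$ is on the scale of the bound, $|\phi^\lambda(0,1)-\phi^\lambda(0,0)|\le\kappa B\lambda\gamma$, then for every $0<\delta<1$ (with $\delta\le 1/2$ if $D=1$), with probability at least $1-\delta$ over the draw of $S_m$, $$\sup_{M\in\mathcal M}\big[\mathrm{err}(M,\mathcal D)-\mathrm{err}(M,S_m)\big]\le C\,B\lambda\gamma\sqrt{\frac{d\,\ln(D/\delta)}{m}}.$$ -/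

import Mathlib

open MeasureTheory
open scoped NNReal ContDiff

noncomputable section

/-- The representation space `ℝ^D` with its Euclidean norm. -/
abbrev Feat (D : ℕ) : Type := EuclideanSpace ℝ (Fin D)

/-- A labelled observation `(x, y)` with `x ∈ ℝ^D` and `y ∈ {0, 1}`. -/
abbrev Obs (D : ℕ) : Type := Feat D × Fin 2

/-- The squared Frobenius norm of a matrix. -/
def frobSq {D : ℕ} (A : Matrix (Fin D) (Fin D) ℝ) : ℝ := ∑ i, ∑ j, A i j ^ 2

/-- Activation functions `ℝ → [-1, 1]`: smooth, strictly monotonic, `γ`-Lipschitz, zero at `0`. -/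
structure IsActivation (γ : ℝ≥0) (σ : ℝ → ℝ) : Prop where
  mem_Icc : ∀ t, σ t ∈ Set.Icc (-1 : ℝ) 1
  smooth : ContDiff ℝ ∞ σ
  strict : StrictMono σ ∨ StrictAnti σ
  lipschitz : LipschitzWith γ σ
  map_zero : σ 0 = 0

/-- Two-layer feed-forward networks on `ℝ^D` with `K` hidden units and activation `σ`:
the functions `x ↦ ∑ i, w i * σ (v i · x)` with `‖w‖₁ ≤ 1` and `‖v i‖₁ ≤ 1` for all `i`. -/
def twoLayerNets (D K : ℕ) (σ : ℝ → ℝ) : Set (Feat D → ℝ) :=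
  {h | ∃ (w : Fin K → ℝ) (v : Fin K → Fin D → ℝ),
    ∑ i, |w i| ≤ 1 ∧ (∀ i, ∑ j, |v i j| ≤ 1) ∧
    ∀ x, h x = ∑ i, w i * σ (∑ j, v i j * x j)}

/-- The image `M x` of an observation under a weighting metric. -/
def applyMetric {D : ℕ} (M : Matrix (Fin D) (Fin D) ℝ) (x : Feat D) : Feat D :=
  Matrix.toEuclideanLin M x

/-- The error of the metric `M` under the distribution `𝒟`, relative to the hypothesis class `H`
and the loss `φ` (first argument: prediction, second argument: label). -/
def errHyp {D : ℕ} (H : Set (Feat D → ℝ)) (φ : ℝ → Fin 2 → ℝ)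
    (M : Matrix (Fin D) (Fin D) ℝ) (𝒟 : Measure (Obs D)) : ℝ :=
  ⨅ h : H, ∫ z, φ (h.1 (applyMetric M z.1)) z.2 ∂𝒟

/-- The empirical error of the metric `M` on the sample `S` of size `m`. -/
def errHypEmp {D m : ℕ} (H : Set (Feat D → ℝ)) (φ : ℝ → Fin 2 → ℝ)
    (M : Matrix (Fin D) (Fin D) ℝ) (S : Fin m → Obs D) : ℝ :=
  ⨅ h : H, (1 / (m : ℝ)) * ∑ i, φ (h.1 (applyMetric M (S i).1)) (S i).2

end

/-! ### Sums over signs -/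

/-! The largest deviation over metrics and nets is controlled through its exponential moment.
Symmetrization with a ghost sample (`integral_exp_iSup_deviation_le`) reduces this moment to sign
sums on a fixed sample, where the network is peeled off layer by layer. The Ledoux-Talagrand
contraction in exponential form (`sum_signs_exp_iSup_contraction`) removes the loss and the
activation at the cost of a factor `λγ`. A linear form on the `ℓ¹` ball is at most its largest
coefficient in absolute value, so `K` disappears. What is left is linear in `x` and bounded by `√d`
times the norm of a Hilbert space sign sum, which is sub-Gaussian with no dimension factor
(`sum_signs_exp_norm_le`).

The loss at prediction `0` still depends on the label; that part does not pass through the net, and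
the hypothesis on `κ` enters only there.

The moment bound `3 exp(m t² V)`, with `V` a multiple of `d (Bλγ)²`, gives a Chernoff tail `3
exp(-3L)` at `L = log(D/δ)`, which is at most `δ`. All this is done for finite families, where
suprema are attained and measurable; a dense sequence of parameters and continuity in the parameters
give the full class. -/

theorem sum_signs_succ {m : ℕ} (F : (Fin (m + 1) → ℤˣ) → ℝ) :
    ∑ ε, F ε = ∑ ε : Fin m → ℤˣ, (F (Fin.cons 1 ε) + F (Fin.cons (-1) ε)) := by
  rw [← (Fin.consEquiv fun _ : Fin (m + 1) => ℤˣ).sum_comp, Fintype.sum_prod_type_right]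
  refine Finset.sum_congr rfl fun ε _ => ?_
  rw [UnitsInt.univ, Finset.sum_pair (by decide)]
  rfl

/-! ### The contraction principle in exponential form -/

theorem exp_add_sub_exp_le {p q α β : ℝ} (hqp : q ≤ p) (hβα : β ≤ α) (hβ : 0 ≤ β) :
    Real.exp (q + β) - Real.exp q ≤ Real.exp (p + α) - Real.exp p := by
  have h1 := Real.exp_le_exp.2 hqp
  have h2 := Real.exp_le_exp.2 hβα
  have h3 := Real.one_le_exp hβ
  have h4 := (Real.exp_pos q).le
  rw [Real.exp_add, Real.exp_add]
  nlinarith [mul_le_mul h1 (sub_le_sub_right h2 1) (by linarith) (Real.exp_pos p).le]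

/-- Read `uᵢ` as `ψ(tᵢ)` with `ψ` 1-Lipschitz and `ψ(0) = 0`. If `t₁`, `t₂` have opposite signs, the
comparison is termwise. If they share a sign, the Lipschitz condition compares two increments of the
exponential, and `ho₁`, `ho₂` place the larger increment at the larger base point. -/
theorem exp_add_exp_le_of_ordered {a₁ u₁ t₁ a₂ u₂ t₂ X Y : ℝ} (h₁ : |u₁| ≤ |t₁|) (h₂ : |u₂| ≤ |t₂|)
    (h₁₂ : |u₁ - u₂| ≤ |t₁ - t₂|) (hX₁ : a₁ + t₁ ≤ X) (hX₂ : a₂ + t₂ ≤ X) (hY₁ : a₁ - t₁ ≤ Y)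
    (hY₂ : a₂ - t₂ ≤ Y) (ho₁ : a₂ + u₂ ≤ a₁ + u₁) (ho₂ : a₁ - u₁ ≤ a₂ - u₂) (ht₁ : 0 ≤ t₁) :
    Real.exp (a₁ + u₁) + Real.exp (a₂ - u₂) ≤ Real.exp X + Real.exp Y := by
  have eX₁ := Real.exp_le_exp.2 hX₁
  have eX₂ := Real.exp_le_exp.2 hX₂
  have eY₁ := Real.exp_le_exp.2 hY₁
  have eY₂ := Real.exp_le_exp.2 hY₂
  rw [abs_of_nonneg ht₁, abs_le] at h₁
  rcases le_total 0 t₂ with ht₂ | ht₂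
  · rw [abs_of_nonneg ht₂, abs_le] at h₂
    rcases le_total t₂ t₁ with ht | ht
    · rw [abs_of_nonneg (sub_nonneg.2 ht), abs_le] at h₁₂
      have := exp_add_sub_exp_le (p := a₁ + u₁) (q := a₂ - t₂) (α := t₁ - u₁) (β := t₂ - u₂)
        (by linarith) (by linarith) (by linarith)
      rw [show a₂ - t₂ + (t₂ - u₂) = a₂ - u₂ by ring,
        show a₁ + u₁ + (t₁ - u₁) = a₁ + t₁ by ring] at this
      linarith
    · rw [abs_of_nonpos (sub_nonpos.2 ht), abs_le] at h₁₂
      -- The indices cross here: `X` absorbs `a₂ + t₂` and `Y` absorbs `a₁ - t₁`.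
      have := exp_add_sub_exp_le (p := a₂ - u₂) (q := a₁ - t₁) (α := t₂ + u₂) (β := t₁ + u₁)
        (by linarith) (by linarith) (by linarith)
      rw [show a₁ - t₁ + (t₁ + u₁) = a₁ + u₁ by ring,
        show a₂ - u₂ + (t₂ + u₂) = a₂ + t₂ by ring] at this
      linarith
  · rw [abs_of_nonpos ht₂, abs_le] at h₂
    exact add_le_add (Real.exp_le_exp.2 (by linarith)) (Real.exp_le_exp.2 (by linarith))

theorem exp_add_exp_le {a₁ u₁ t₁ a₂ u₂ t₂ X Y : ℝ} (h₁ : |u₁| ≤ |t₁|) (h₂ : |u₂| ≤ |t₂|)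
    (h₁₂ : |u₁ - u₂| ≤ |t₁ - t₂|) (hX₁ : a₁ + t₁ ≤ X) (hX₂ : a₂ + t₂ ≤ X) (hY₁ : a₁ - t₁ ≤ Y)
    (hY₂ : a₂ - t₂ ≤ Y) :
    Real.exp (a₁ + u₁) + Real.exp (a₂ - u₂) ≤ Real.exp X + Real.exp Y := by
  have key : ∀ {a₁ u₁ t₁ a₂ u₂ t₂ : ℝ}, |u₁| ≤ |t₁| → |u₂| ≤ |t₂| → |u₁ - u₂| ≤ |t₁ - t₂| →
      a₁ + t₁ ≤ X → a₂ + t₂ ≤ X → a₁ - t₁ ≤ Y → a₂ - t₂ ≤ Y → a₂ + u₂ ≤ a₁ + u₁ →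
      a₁ - u₁ ≤ a₂ - u₂ →
      Real.exp (a₁ + u₁) + Real.exp (a₂ - u₂) ≤ Real.exp X + Real.exp Y := by
    intro a₁ u₁ t₁ a₂ u₂ t₂ h₁ h₂ h₁₂ hX₁ hX₂ hY₁ hY₂ ho₁ ho₂
    rcases le_total 0 t₁ with ht | ht
    · exact exp_add_exp_le_of_ordered h₁ h₂ h₁₂ hX₁ hX₂ hY₁ hY₂ ho₁ ho₂ ht
    -- Reflecting `t` exchanges the roles of `X` and `Y`.
    · rw [add_comm (Real.exp X)]
      refine exp_add_exp_le_of_ordered (u₁ := u₁) (u₂ := u₂) (t₁ := -t₁) (t₂ := -t₂)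
        (by rwa [abs_neg]) (by rwa [abs_neg]) ?_ (by linarith) (by linarith) (by linarith) (by linarith) ho₁ ho₂
        (by linarith)
      rwa [neg_sub_neg, abs_sub_comm t₂]
  rcases le_total (a₂ + u₂) (a₁ + u₁) with ho₁ | ho₁
  · rcases le_total (a₁ - u₁) (a₂ - u₂) with ho₂ | ho₂
    · exact key h₁ h₂ h₁₂ hX₁ hX₂ hY₁ hY₂ ho₁ ho₂
    -- Index 1 is at least as good in both exponents, so it is used twice.
    · have := key h₁ h₁ (by simp) hX₁ hX₁ hY₁ hY₁ le_rfl le_rfl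
      linarith [Real.exp_le_exp.2 ho₂]
  · have := key h₂ h₂ (by simp) hX₂ hX₂ hY₂ hY₂ le_rfl le_rfl
    linarith [Real.exp_le_exp.2 ho₁]

section Contraction

theorem le_iSup_of_finite {ι : Type*} [Finite ι] (f : ι → ℝ) (k : ι) : f k ≤ ⨆ k, f k :=
  le_ciSup (Set.finite_range f).bddAbove k

variable {ι : Type*} [Finite ι] [Nonempty ι]

theorem exists_eq_iSup_of_finite (f : ι → ℝ) : ∃ k, f k = ⨆ k, f k :=
  Set.mem_range.1 ((Set.range_nonempty f).csSup_mem (Set.finite_range f))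

theorem exp_iSup_add_exp_iSup_le (a u t : ι → ℝ) (h : ∀ k, |u k| ≤ |t k|)
    (hd : ∀ k l, |u k - u l| ≤ |t k - t l|) :
    Real.exp (⨆ k, (a k + u k)) + Real.exp (⨆ k, (a k - u k)) ≤
      Real.exp (⨆ k, (a k + t k)) + Real.exp (⨆ k, (a k - t k)) := by
  obtain ⟨k, hk⟩ := exists_eq_iSup_of_finite fun k => a k + u k
  obtain ⟨l, hl⟩ := exists_eq_iSup_of_finite fun k => a k - u k
  rw [← hk, ← hl]
  exact exp_add_exp_le (h k) (h l) (hd k l) (le_iSup_of_finite (fun k => a k + t k) k)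
    (le_iSup_of_finite (fun k => a k + t k) l) (le_iSup_of_finite (fun k => a k - t k) k)
    (le_iSup_of_finite (fun k => a k - t k) l)

/-- The Ledoux-Talagrand contraction principle for the exponential function. -/
theorem sum_signs_exp_iSup_contraction {m : ℕ} (u t : ι → Fin m → ℝ)
    (h : ∀ k i, |u k i| ≤ |t k i|) (hd : ∀ k l i, |u k i - u l i| ≤ |t k i - t l i|)
    (a : ι → ℝ) :
    ∑ ε : Fin m → ℤˣ, Real.exp (⨆ k, (a k + ∑ i, ((ε i : ℤ) : ℝ) * u k i)) ≤
      ∑ ε : Fin m → ℤˣ, Real.exp (⨆ k, (a k + ∑ i, ((ε i : ℤ) : ℝ) * t k i)) := by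
  induction m generalizing a with
  | zero => simp
  | succ m ih =>
    -- The offset must be arbitrary: it absorbs the first coordinate with either sign, and later the
    -- remaining sum when the two-point inequality is applied.
    have IH := fun a => ih (fun k i => u k i.succ) (fun k i => t k i.succ)
      (fun k i => h k i.succ) (fun k l i => hd k l i.succ) a
    rw [sum_signs_succ, sum_signs_succ]
    simp only [Fin.sum_univ_succ, Fin.cons_zero, Fin.cons_succ, Units.val_one, Units.val_neg,
      Int.cast_one, Int.cast_neg, one_mul, neg_mul]
    calc _ = ∑ ε : Fin m → ℤˣ,
            Real.exp (⨆ k, ((a k + u k 0) + ∑ i, ((ε i : ℤ) : ℝ) * u k i.succ)) +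
          ∑ ε : Fin m → ℤˣ,
            Real.exp (⨆ k, ((a k - u k 0) + ∑ i, ((ε i : ℤ) : ℝ) * u k i.succ)) := by
          rw [← Finset.sum_add_distrib]
          simp only [add_assoc, sub_eq_add_neg]
      _ ≤ ∑ ε : Fin m → ℤˣ,
            Real.exp (⨆ k, ((a k + u k 0) + ∑ i, ((ε i : ℤ) : ℝ) * t k i.succ)) +
          ∑ ε : Fin m → ℤˣ,
            Real.exp (⨆ k, ((a k - u k 0) + ∑ i, ((ε i : ℤ) : ℝ) * t k i.succ)) :=
          add_le_add (IH _) (IH _)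
      _ = ∑ ε : Fin m → ℤˣ,
            (Real.exp (⨆ k, ((a k + ∑ i, ((ε i : ℤ) : ℝ) * t k i.succ) + u k 0)) +
            Real.exp (⨆ k, ((a k + ∑ i, ((ε i : ℤ) : ℝ) * t k i.succ) - u k 0))) := by
          rw [← Finset.sum_add_distrib]
          simp only [add_right_comm, sub_add_eq_add_sub]
      _ ≤ ∑ ε : Fin m → ℤˣ,
            (Real.exp (⨆ k, ((a k + ∑ i, ((ε i : ℤ) : ℝ) * t k i.succ) + t k 0)) +
            Real.exp (⨆ k, ((a k + ∑ i, ((ε i : ℤ) : ℝ) * t k i.succ) - t k 0))) :=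
          Finset.sum_le_sum fun ε _ => exp_iSup_add_exp_iSup_le _ _ _ (fun k => h k 0)
            (fun k l => hd k l 0)
      _ = _ := by
          refine Finset.sum_congr rfl fun ε _ => ?_
          congr 3 <;> (ext k; ring)

end Contraction

/-! ### Exponential moments of sign sums in a Hilbert space -/

/-- `u` and `v` are complementary convex combinations of `c` and `d`; the two convexity inequalities
add up. -/
theorem pow_add_pow_le_of_add_eq {u v c d : ℝ} (hc : 0 ≤ c) (hcu : c ≤ u) (hud : u ≤ d)
    (h : u + v = c + d) (n : ℕ) : u ^ n + v ^ n ≤ c ^ n + d ^ n := by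
  rcases (hcu.trans hud).eq_or_lt with rfl | hcd
  · obtain rfl : u = c := le_antisymm hud hcu
    obtain rfl : v = u := by linarith
    exact le_rfl
  · have hcd' : 0 < d - c := sub_pos.2 hcd
    have hcv := convexOn_pow (𝕜 := ℝ) n
    have hα : 0 ≤ (d - u) / (d - c) := div_nonneg (by linarith) hcd'.le
    have hβ : 0 ≤ (u - c) / (d - c) := div_nonneg (by linarith) hcd'.le
    have hαβ : (d - u) / (d - c) + (u - c) / (d - c) = 1 := by field_simp; ring
    have h1 := hcv.2 (Set.mem_Ici.2 hc) (Set.mem_Ici.2 (hc.trans hcd.le)) hα hβ hαβ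
    have h2 := hcv.2 (Set.mem_Ici.2 hc) (Set.mem_Ici.2 (hc.trans hcd.le)) hβ hα
      (by rw [add_comm, hαβ])
    have e1 : ((d - u) / (d - c)) • c + ((u - c) / (d - c)) • d = u := by
      simp only [smul_eq_mul]; field_simp; ring
    have e2 : ((u - c) / (d - c)) • c + ((d - u) / (d - c)) • d = v := by
      obtain rfl : v = c + d - u := by linarith
      simp only [smul_eq_mul]; field_simp; ring
    rw [e1] at h1
    rw [e2] at h2
    simp only [smul_eq_mul] at h1 h2
    calc u ^ n + v ^ n ≤ ((d - u) / (d - c) + (u - c) / (d - c)) * (c ^ n + d ^ n) := by linarith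
      _ = _ := by rw [hαβ, one_mul]

section Hilbert

variable {E : Type*} [NormedAddCommGroup E] [InnerProductSpace ℝ E]

/-- By the parallelogram law, `‖x ± y‖²` have the same sum as `(‖x‖ ± ‖y‖)²`, and by Cauchy-Schwarz
they lie between them. Since `cosh` is a power series in the square with nonnegative coefficients,
the comparison holds term by term. -/
theorem cosh_norm_add_add_cosh_norm_sub_le (x y : E) :
    Real.cosh ‖x + y‖ + Real.cosh ‖x - y‖ ≤ 2 * (Real.cosh ‖x‖ * Real.cosh ‖y‖) := by
  have e : 2 * (Real.cosh ‖x‖ * Real.cosh ‖y‖) =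
      Real.cosh (‖x‖ - ‖y‖) + Real.cosh (‖x‖ + ‖y‖) := by
    rw [Real.cosh_add, Real.cosh_sub]; ring
  rw [e]
  refine hasSum_le (fun n => ?_) ((Real.hasSum_cosh _).add (Real.hasSum_cosh _))
    ((Real.hasSum_cosh _).add (Real.hasSum_cosh _))
  simp only [← add_div, pow_mul]
  refine div_le_div_of_nonneg_right ?_ (Nat.cast_nonneg _)
  have hxy := abs_le.1 (abs_real_inner_le_norm x y)
  have h1 := norm_add_sq_real x y
  have h2 := norm_sub_sq_real x y
  refine pow_add_pow_le_of_add_eq (sq_nonneg _) ?_ ?_ ?_ n <;> nlinarith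

/-- The vector `x` carries the signs already fixed; each further sign costs a factor `2 cosh ‖y i‖`,
whatever the dimension. -/
theorem sum_signs_cosh_norm_le {m : ℕ} (y : Fin m → E) (x : E) :
    ∑ ε : Fin m → ℤˣ, Real.cosh ‖x + ∑ i, ((ε i : ℤ) : ℝ) • y i‖ ≤
      2 ^ m * (Real.cosh ‖x‖ * ∏ i, Real.cosh ‖y i‖) := by
  induction m generalizing x with
  | zero => simp
  | succ m ih =>
    rw [sum_signs_succ]
    simp only [Fin.sum_univ_succ, Fin.cons_zero, Fin.cons_succ, Units.val_one, Units.val_neg,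
      Int.cast_one, Int.cast_neg, one_smul, neg_smul, Finset.sum_add_distrib, ← add_assoc,
      ← sub_eq_add_neg, Fin.prod_univ_succ]
    have hP : 0 ≤ ∏ i : Fin m, Real.cosh ‖y i.succ‖ :=
      Finset.prod_nonneg fun i _ => (Real.cosh_pos _).le
    calc _ ≤ 2 ^ m * (Real.cosh ‖x + y 0‖ * ∏ i : Fin m, Real.cosh ‖y i.succ‖) +
          2 ^ m * (Real.cosh ‖x - y 0‖ * ∏ i : Fin m, Real.cosh ‖y i.succ‖) :=
          add_le_add (ih _ _) (ih _ _)
      _ = (Real.cosh ‖x + y 0‖ + Real.cosh ‖x - y 0‖) *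
          (2 ^ m * ∏ i : Fin m, Real.cosh ‖y i.succ‖) := by ring
      _ ≤ (2 * (Real.cosh ‖x‖ * Real.cosh ‖y 0‖)) *
          (2 ^ m * ∏ i : Fin m, Real.cosh ‖y i.succ‖) := by
          gcongr
          exact cosh_norm_add_add_cosh_norm_sub_le x (y 0)
      _ = _ := by ring

theorem sum_signs_exp_norm_le {m : ℕ} (y : Fin m → E) :
    ∑ ε : Fin m → ℤˣ, Real.exp ‖∑ i, ((ε i : ℤ) : ℝ) • y i‖ ≤
      2 ^ m * (2 * Real.exp (∑ i, ‖y i‖ ^ 2 / 2)) := by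
  have h := sum_signs_cosh_norm_le y 0
  simp only [zero_add, norm_zero, Real.cosh_zero, one_mul] at h
  calc _ ≤ ∑ ε : Fin m → ℤˣ, 2 * Real.cosh ‖∑ i, ((ε i : ℤ) : ℝ) • y i‖ := by
        refine Finset.sum_le_sum fun ε _ => ?_
        rw [Real.cosh_eq]
        linarith [Real.exp_pos (-‖∑ i, ((ε i : ℤ) : ℝ) • y i‖)]
    _ ≤ 2 * (2 ^ m * ∏ i, Real.cosh ‖y i‖) := by
        rw [← Finset.mul_sum]; gcongr
    _ ≤ 2 * (2 ^ m * ∏ i, Real.exp (‖y i‖ ^ 2 / 2)) := by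
        gcongr with i
        exact Real.cosh_le_exp_half_sq _
    _ = _ := by rw [← Real.exp_sum]; ring

/-- The exponential moment of the supremum of a sign sum over finitely many two-layer nets. -/
theorem sum_signs_exp_iSup_net_le {ι : Type*} [Finite ι] [Nonempty ι] {K m : ℕ}
    (w : ι → Fin K → ℝ) (hw : ∀ k, ∑ j, |w k j| ≤ 1) (ℓ : ι → Fin K → E →ₗ[ℝ] ℝ) {R : ℝ}
    (hR : 0 ≤ R) (hℓ : ∀ k j x, |ℓ k j x| ≤ R * ‖x‖) {γ : ℝ≥0} {σ : ℝ → ℝ}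
    (hσ : LipschitzWith γ σ) (hσ0 : σ 0 = 0) {B : ℝ} (x : Fin m → E) (hx : ∀ i, ‖x i‖ ≤ B)
    {r : ℝ} (hr : 0 ≤ r) :
    ∑ ε : Fin m → ℤˣ,
        Real.exp (⨆ k, ∑ i, ((ε i : ℤ) : ℝ) * (r * ∑ j, w k j * σ (ℓ k j (x i)))) ≤
      2 ^ m * (4 * Real.exp (m * (r * γ * R * B) ^ 2 / 2)) := by
  have hσd : ∀ s t, |σ s - σ t| ≤ γ * |s - t| := fun s t => by
    simpa [Real.dist_eq] using hσ.dist_le_mul s t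
  have hσa : ∀ s, |σ s| ≤ γ * |s| := fun s => by simpa [hσ0] using hσd s 0
  have hrγ : 0 ≤ r * γ := by positivity
  -- The extra index, with the zero functional, keeps the family nonempty when `K = 0`.
  let L : Option (ι × Fin K) → E →ₗ[ℝ] ℝ := fun p => p.elim 0 fun q => ℓ q.1 q.2
  have hL : ∀ p x, |L p x| ≤ R * ‖x‖ := by
    rintro (_ | ⟨k, j⟩) x
    · simp only [L, Option.elim_none, LinearMap.zero_apply, abs_zero]
      positivity
    · exact hℓ k j x
  let T : (Fin m → ℤˣ) → Option (ι × Fin K) → ℝ :=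
    fun ε p => ∑ i, ((ε i : ℤ) : ℝ) * (r * σ (L p (x i)))
  have hlin : ∀ ε : Fin m → ℤˣ, (⨆ p, ((0 : ℝ) + ∑ i, ((ε i : ℤ) : ℝ) * (r * γ * L p (x i)))) ≤
      ‖∑ i, ((ε i : ℤ) : ℝ) • (r * γ * R) • x i‖ := by
    intro ε
    refine ciSup_le fun p => ?_
    have e1 : (0 : ℝ) + ∑ i, ((ε i : ℤ) : ℝ) * (r * γ * L p (x i)) =
        r * γ * L p (∑ i, ((ε i : ℤ) : ℝ) • x i) := by
      rw [zero_add, map_sum, Finset.mul_sum]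
      exact Finset.sum_congr rfl fun i _ => by rw [map_smul, smul_eq_mul]; ring
    have e2 : ∑ i, ((ε i : ℤ) : ℝ) • (r * γ * R) • x i =
        (r * γ * R) • ∑ i, ((ε i : ℤ) : ℝ) • x i := by
      rw [Finset.smul_sum]
      exact Finset.sum_congr rfl fun i _ => smul_comm _ _ _
    rw [e1, e2, norm_smul, Real.norm_of_nonneg (by positivity), mul_assoc (r * γ) R]
    gcongr
    exact (le_abs_self _).trans (hL p _)
  have hbound : ∑ ε : Fin m → ℤˣ,
      Real.exp (⨆ p, ((0 : ℝ) + ∑ i, ((ε i : ℤ) : ℝ) * (r * γ * L p (x i)))) ≤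
      2 ^ m * (2 * Real.exp (m * (r * γ * R * B) ^ 2 / 2)) := by
    refine (Finset.sum_le_sum fun ε _ => Real.exp_le_exp.2 (hlin ε)).trans
      ((sum_signs_exp_norm_le _).trans ?_)
    gcongr
    calc ∑ i, ‖(r * γ * R) • x i‖ ^ 2 / 2 ≤ ∑ _i : Fin m, (r * γ * R * B) ^ 2 / 2 := by
          gcongr with i
          rw [norm_smul, Real.norm_of_nonneg (by positivity)]
          gcongr
          exact hx i
      _ = _ := by rw [Finset.sum_const, Finset.card_univ, Fintype.card_fin, nsmul_eq_mul]; ring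
  have hpos : ∑ ε, Real.exp (⨆ p, T ε p) ≤
      2 ^ m * (2 * Real.exp (m * (r * γ * R * B) ^ 2 / 2)) := by
    refine le_trans ?_ hbound
    have := sum_signs_exp_iSup_contraction (fun p i => r * σ (L p (x i)))
      (fun p i => r * γ * L p (x i)) (fun p i => ?_) (fun p q i => ?_) 0
    · simpa only [Pi.zero_apply, zero_add] using this
    · rw [abs_mul, abs_mul, abs_of_nonneg hr, abs_of_nonneg hrγ, mul_assoc]
      gcongr
      exact hσa _
    · rw [← mul_sub, ← mul_sub, abs_mul, abs_mul, abs_of_nonneg hr,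
        abs_of_nonneg hrγ, mul_assoc]
      gcongr
      exact hσd _ _
  have hneg : ∑ ε, Real.exp (⨆ p, -T ε p) ≤
      2 ^ m * (2 * Real.exp (m * (r * γ * R * B) ^ 2 / 2)) := by
    refine le_trans (le_of_eq ?_) hpos
    rw [← Equiv.sum_comp (Equiv.neg (Fin m → ℤˣ))]
    refine Finset.sum_congr rfl fun ε _ => ?_
    simp only [T, Equiv.neg_apply, Pi.neg_apply, Units.val_neg, Int.cast_neg, neg_mul,
      Finset.sum_neg_distrib, neg_neg]
  calc _ ≤ ∑ ε, (Real.exp (⨆ p, T ε p) + Real.exp (⨆ p, -T ε p)) := by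
        refine Finset.sum_le_sum fun ε _ => ?_
        -- By `ℓ¹`-`ℓ^∞` duality the best single unit dominates every net. Its absolute value is
        -- handled by both one-sided suprema, which doubles the constant to 4.
        obtain ⟨q, hq⟩ := exists_eq_iSup_of_finite fun p => |T ε p|
        have hle : (⨆ k, ∑ i, ((ε i : ℤ) : ℝ) * (r * ∑ j, w k j * σ (ℓ k j (x i)))) ≤
            |T ε q| := by
          refine ciSup_le fun k => ?_
          have e : ∑ i, ((ε i : ℤ) : ℝ) * (r * ∑ j, w k j * σ (ℓ k j (x i))) =
              ∑ j, w k j * T ε (some (k, j)) := by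
            simp only [T, L, Option.elim_some, Finset.mul_sum]
            rw [Finset.sum_comm]
            exact Finset.sum_congr rfl fun j _ => Finset.sum_congr rfl fun i _ => by ring
          rw [e]
          calc _ ≤ ∑ j, |w k j| * |T ε q| := by
                refine Finset.sum_le_sum fun j _ => (le_abs_self _).trans ?_
                rw [abs_mul, hq]
                refine mul_le_mul_of_nonneg_left ?_ (abs_nonneg _)
                exact le_iSup_of_finite (fun p => |T ε p|) _
            _ ≤ 1 * |T ε q| := by rw [← Finset.sum_mul]; gcongr; exact hw k
            _ = _ := one_mul _
        refine (Real.exp_le_exp.2 hle).trans ?_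
        have h1 := Real.exp_le_exp.2 (le_iSup_of_finite (T ε) q)
        have h2 := Real.exp_le_exp.2 (le_iSup_of_finite (fun p => -T ε p) q)
        rcases abs_cases (T ε q) with ⟨h, _⟩ | ⟨h, _⟩ <;> rw [h]
        · linarith [Real.exp_pos (⨆ p, -T ε p)]
        · linarith [Real.exp_pos (⨆ p, T ε p)]
    _ ≤ _ := by rw [Finset.sum_add_distrib]; linarith

end Hilbert

/-! ### Symmetrization for exponential moments -/

section Symmetrization

theorem exp_integral_le {Ω : Type*} [MeasurableSpace Ω] {μ : Measure Ω} [IsProbabilityMeasure μ]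
    {g : Ω → ℝ} (hg : Integrable g μ) (hge : Integrable (fun x => Real.exp (g x)) μ) :
    Real.exp (∫ x, g x ∂μ) ≤ ∫ x, Real.exp (g x) ∂μ :=
  convexOn_exp.map_integral_le Real.continuous_exp.continuousOn isClosed_univ (by simp) hg hge

theorem measurable_exp_iSup_mul_sum {ι : Type*} [Finite ι] {m : ℕ} {Ω : Type*} [MeasurableSpace Ω] {g : ι → Fin m → Ω → ℝ}
    (hg : ∀ k i, Measurable (g k i)) (t : ℝ) :
    Measurable fun x => Real.exp (⨆ k, t * ∑ i, g k i x) :=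
  Real.measurable_exp.comp (Measurable.iSup fun k =>
    (Finset.measurable_sum _ fun i _ => hg k i).const_mul t)

variable {ι Z : Type*} [Finite ι] [Nonempty ι] [MeasurableSpace Z] {m : ℕ}

theorem integrable_exp_iSup_mul_sum {Ω : Type*} [MeasurableSpace Ω] {μ : Measure Ω}
    [IsFiniteMeasure μ] {g : ι → Fin m → Ω → ℝ} (hg : ∀ k i, Measurable (g k i)) {c : ℝ}
    (hc : ∀ k i x, |g k i x| ≤ c) {t : ℝ} (ht : 0 ≤ t) :
    Integrable (fun x => Real.exp (⨆ k, t * ∑ i, g k i x)) μ := by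
  refine Integrable.of_bound (measurable_exp_iSup_mul_sum hg t).aestronglyMeasurable
    (Real.exp (t * ∑ _i : Fin m, c)) (ae_of_all _ fun x => ?_)
  rw [Real.norm_of_nonneg (Real.exp_pos _).le, Real.exp_le_exp]
  refine ciSup_le fun k => ?_
  gcongr with i
  exact (le_abs_self _).trans (hc k i x)

/-- For fixed `S` the supremum is attained at some `k`; the mean of `f k` is an average over an
independent sample, and Jensen's inequality moves the exponential inside that average. -/
theorem integral_exp_iSup_deviation_le_ghost {𝒟 : Measure Z} [IsProbabilityMeasure 𝒟]
    {f : ι → Z → ℝ} (hf : ∀ k, Measurable (f k)) {c : ℝ} (hc : ∀ k z, |f k z| ≤ c) {t : ℝ}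
    (ht : 0 ≤ t) :
    ∫ S, Real.exp (⨆ k, t * ∑ i, (∫ z, f k z ∂𝒟 - f k (S i))) ∂(Measure.pi fun _ : Fin m => 𝒟) ≤
      ∫ ζ, Real.exp (⨆ k, t * ∑ i, (f k (ζ i).1 - f k (ζ i).2))
        ∂(Measure.pi fun _ : Fin m => 𝒟.prod 𝒟) := by
  set P := Measure.pi fun _ : Fin m => 𝒟 with hP
  have hm : ∀ k (i : Fin m), Measurable fun p : (Fin m → Z) × (Fin m → Z) =>
      f k (p.1 i) - f k (p.2 i) := fun k i =>
    ((hf k).comp ((measurable_pi_apply i).comp measurable_fst)).sub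
      ((hf k).comp ((measurable_pi_apply i).comp measurable_snd))
  have hb : ∀ k z z', |f k z - f k z'| ≤ c + c := fun k z z' =>
    (abs_sub _ _).trans (add_le_add (hc _ _) (hc _ _))
  have hI : ∀ k, |∫ z, f k z ∂𝒟| ≤ c := fun k => by
    simpa using norm_integral_le_of_norm_le_const (μ := 𝒟) (f := f k) (ae_of_all _ (hc k))
  have hint : Integrable (fun p : (Fin m → Z) × (Fin m → Z) =>
      Real.exp (⨆ k, t * ∑ i, (f k (p.1 i) - f k (p.2 i)))) (P.prod P) :=
    integrable_exp_iSup_mul_sum hm (fun k i p => hb k _ _) ht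
  have hmp := measurePreserving_arrowProdEquivProdArrow Z Z (Fin m) (fun _ => 𝒟) (fun _ => 𝒟)
  have htransfer := hmp.integral_comp' (g := fun p : (Fin m → Z) × (Fin m → Z) =>
      Real.exp (⨆ k, t * ∑ i, (f k (p.1 i) - f k (p.2 i))))
  refine le_trans ?_ (le_of_eq htransfer.symm)
  rw [← hP, integral_prod_symm _ hint]
  refine integral_mono ?_ hint.integral_prod_right fun S => ?_
  · refine integrable_exp_iSup_mul_sum (c := c + c) (fun k i => ?_) (fun k i S => ?_) ht
    · exact measurable_const.sub ((hf k).comp (measurable_pi_apply i))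
    · exact (abs_sub _ _).trans (add_le_add (hI k) (hc _ _))
  · obtain ⟨k, hk⟩ := exists_eq_iSup_of_finite fun k => t * ∑ i, (∫ z, f k z ∂𝒟 - f k (S i))
    have hfi : ∀ i : Fin m, Integrable (fun z' : Fin m → Z => f k (z' i)) P := fun i =>
      Integrable.of_bound ((hf k).comp (measurable_pi_apply i)).aestronglyMeasurable c
        (ae_of_all _ fun z' => hc k _)
    have hev : ∀ i : Fin m, ∫ z', f k (z' i) ∂P = ∫ z, f k z ∂𝒟 := fun i =>
      integral_comp_eval (μ := fun _ : Fin m => 𝒟) (hf k).aestronglyMeasurable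
    have hgi : Integrable (fun z' : Fin m → Z => t * ∑ i, (f k (z' i) - f k (S i))) P :=
      (integrable_finsetSum _ fun i _ => (hfi i).sub (integrable_const _)).const_mul t
    have hei : Integrable (fun z' : Fin m → Z =>
        Real.exp (t * ∑ i, (f k (z' i) - f k (S i)))) P := by
      have := integrable_exp_iSup_mul_sum (ι := Unit) (μ := P)
        (g := fun _ i z' => f k (z' i) - f k (S i))
        (fun _ i => ((hf k).comp (measurable_pi_apply i)).sub measurable_const)
        (fun _ i z' => hb k _ _) ht
      simpa using this
    have hsi : Integrable (fun z' : Fin m → Z =>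
        Real.exp (⨆ k, t * ∑ i, (f k (z' i) - f k (S i)))) P :=
      integrable_exp_iSup_mul_sum
        (fun k i => ((hf k).comp (measurable_pi_apply i)).sub measurable_const)
        (fun k i z' => hb k _ _) ht
    have hval : ∫ z', t * ∑ i, (f k (z' i) - f k (S i)) ∂P =
        t * ∑ i, (∫ z, f k z ∂𝒟 - f k (S i)) := by
      rw [integral_const_mul, integral_finsetSum 
        (f := fun i (z' : Fin m → Z) => f k (z' i) - f k (S i)) _
        fun i _ => (hfi i).sub (integrable_const _)]
      congr 1
      refine Finset.sum_congr rfl fun i _ => ?_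
      rw [integral_sub (hfi i) (integrable_const _), hev i]
      simp
    simp only
    rw [← hk, ← hval]
    refine (exp_integral_le hgi hei).trans (integral_mono hei hsi fun z' => ?_)
    exact Real.exp_le_exp.2 (le_iSup_of_finite
      (fun k => t * ∑ i, (f k (z' i) - f k (S i))) k)

/-- Exchange the two entries of a pair when the sign is negative. -/
def swapBySign (u : ℤˣ) (p : Z × Z) : Z × Z := if u = 1 then p else p.swap

theorem measurePreserving_swapBySign (𝒟 : Measure Z) [IsProbabilityMeasure 𝒟] (u : ℤˣ) :
    MeasurePreserving (swapBySign u) (𝒟.prod 𝒟) (𝒟.prod 𝒟) := by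
  rcases Int.units_eq_one_or u with rfl | rfl
  · exact MeasurePreserving.id _
  · exact Measure.measurePreserving_swap

theorem sub_swapBySign {Z : Type*} (f : Z → ℝ) (u : ℤˣ) (p : Z × Z) :
    f (swapBySign u p).1 - f (swapBySign u p).2 = ((u : ℤ) : ℝ) * (f p.1 - f p.2) := by
  rcases Int.units_eq_one_or u with rfl | rfl <;> simp [swapBySign]

/-- The inequality `exp(p/2 + q/2) ≤ (exp p + exp q)/2` separates the two samples at the price of
doubling `t`; negating all signs removes the minus. -/
theorem sum_signs_exp_iSup_sub_le (a b : ι → Fin m → ℝ) {t V : ℝ}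
    (ha : ∑ ε : Fin m → ℤˣ, Real.exp (⨆ k, 2 * t * ∑ i, ((ε i : ℤ) : ℝ) * a k i) ≤ V)
    (hb : ∑ ε : Fin m → ℤˣ, Real.exp (⨆ k, 2 * t * ∑ i, ((ε i : ℤ) : ℝ) * b k i) ≤ V) :
    ∑ ε : Fin m → ℤˣ, Real.exp (⨆ k, t * ∑ i, ((ε i : ℤ) : ℝ) * (a k i - b k i)) ≤ V := by
  rw [← Equiv.sum_comp (Equiv.neg (Fin m → ℤˣ))] at hb
  have key : ∀ ε : Fin m → ℤˣ,
      Real.exp (⨆ k, t * ∑ i, ((ε i : ℤ) : ℝ) * (a k i - b k i)) ≤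
      (Real.exp (⨆ k, 2 * t * ∑ i, ((ε i : ℤ) : ℝ) * a k i) +
        Real.exp (⨆ k, 2 * t * ∑ i, (((-ε) i : ℤ) : ℝ) * b k i)) / 2 := by
    intro ε
    set p := ⨆ k, 2 * t * ∑ i, ((ε i : ℤ) : ℝ) * a k i
    set q := ⨆ k, 2 * t * ∑ i, (((-ε) i : ℤ) : ℝ) * b k i
    have h : (⨆ k, t * ∑ i, ((ε i : ℤ) : ℝ) * (a k i - b k i)) ≤ p / 2 + q / 2 := by
      refine ciSup_le fun k => ?_
      have h1 := le_iSup_of_finite (fun k => 2 * t * ∑ i, ((ε i : ℤ) : ℝ) * a k i) k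
      have h2 := le_iSup_of_finite (fun k => 2 * t * ∑ i, (((-ε) i : ℤ) : ℝ) * b k i) k
      simp only [Pi.neg_apply, Units.val_neg, Int.cast_neg, neg_mul, Finset.sum_neg_distrib] at h2
      simp only [mul_sub, Finset.sum_sub_distrib]
      simp only [p, q, Pi.neg_apply, Units.val_neg, Int.cast_neg, neg_mul, Finset.sum_neg_distrib]
      linarith
    refine (Real.exp_le_exp.2 h).trans ?_
    have e1 : Real.exp p = Real.exp (p / 2) ^ 2 := by rw [← Real.exp_nat_mul]; congr 1; ring
    have e2 : Real.exp q = Real.exp (q / 2) ^ 2 := by rw [← Real.exp_nat_mul]; congr 1; ring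
    rw [Real.exp_add, e1, e2]
    nlinarith [sq_nonneg (Real.exp (p / 2) - Real.exp (q / 2))]
  refine (Finset.sum_le_sum fun ε _ => key ε).trans ?_
  rw [← Finset.sum_div, Finset.sum_add_distrib]
  simp only [Equiv.neg_apply] at hb
  linarith

/-- Symmetrization: the exponential moment of the largest deviation of an empirical mean is
controlled by sign sums on almost every sample. -/
theorem integral_exp_iSup_deviation_le {𝒟 : Measure Z} [IsProbabilityMeasure 𝒟]
    {f : ι → Z → ℝ} (hf : ∀ k, Measurable (f k)) {c : ℝ} (hc : ∀ k z, |f k z| ≤ c) {t : ℝ}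
    (ht : 0 ≤ t) {p : Z → Prop} (hp : ∀ᵐ z ∂𝒟, p z) {W : ℝ}
    (hW : ∀ S : Fin m → Z, (∀ i, p (S i)) → ∑ ε : Fin m → ℤˣ,
      Real.exp (⨆ k, 2 * t * ∑ i, ((ε i : ℤ) : ℝ) * f k (S i)) ≤ 2 ^ m * W) :
    ∫ S, Real.exp (⨆ k, t * ∑ i, (∫ z, f k z ∂𝒟 - f k (S i))) ∂(Measure.pi fun _ : Fin m => 𝒟) ≤
      W := by
  refine (integral_exp_iSup_deviation_le_ghost hf hc ht).trans ?_
  set Q := Measure.pi fun _ : Fin m => 𝒟.prod 𝒟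
  set J := ∫ ζ, Real.exp (⨆ k, t * ∑ i, (f k (ζ i).1 - f k (ζ i).2)) ∂Q
  have hm : ∀ k (i : Fin m), Measurable fun ζ : Fin m → Z × Z => f k (ζ i).1 - f k (ζ i).2 :=
    fun k i => ((hf k).comp (measurable_fst.comp (measurable_pi_apply i))).sub
      ((hf k).comp (measurable_snd.comp (measurable_pi_apply i)))
  have hb : ∀ k z z', |f k z - f k z'| ≤ c + c := fun k z z' =>
    (abs_sub _ _).trans (add_le_add (hc _ _) (hc _ _))
  -- Swapping the pairs where `ε` is negative preserves the product law, so every sign pattern has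
  -- the same integral and `J` equals the average over signs.
  have hJ : ∀ ε : Fin m → ℤˣ,
      ∫ ζ, Real.exp (⨆ k, t * ∑ i, ((ε i : ℤ) : ℝ) * (f k (ζ i).1 - f k (ζ i).2)) ∂Q = J := by
    intro ε
    have hmp : MeasurePreserving (fun (ζ : Fin m → Z × Z) i => swapBySign (ε i) (ζ i)) Q Q :=
      measurePreserving_pi _ _ fun i => measurePreserving_swapBySign 𝒟 (ε i)
    have hmeas := measurable_exp_iSup_mul_sum hm t
    have := integral_map (μ := Q) (f := fun ζ : Fin m → Z × Z =>
        Real.exp (⨆ k, t * ∑ i, (f k (ζ i).1 - f k (ζ i).2))) hmp.measurable.aemeasurable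
      (hmp.map_eq.symm ▸ hmeas.aestronglyMeasurable)
    rw [hmp.map_eq] at this
    simp only [sub_swapBySign] at this
    exact this.symm
  have hεint : ∀ ε : Fin m → ℤˣ, Integrable (fun ζ : Fin m → Z × Z =>
      Real.exp (⨆ k, t * ∑ i, ((ε i : ℤ) : ℝ) * (f k (ζ i).1 - f k (ζ i).2))) Q := by
    intro ε
    refine integrable_exp_iSup_mul_sum (fun k i => (hm k i).const_mul _) (c := c + c)
      (fun k i ζ => ?_) ht
    rcases Int.units_eq_one_or (ε i) with h | h <;> simp only [h, abs_mul] <;>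
      simpa using hb k _ _
  have hcard : ∑ ε : Fin m → ℤˣ,
      ∫ ζ, Real.exp (⨆ k, t * ∑ i, ((ε i : ℤ) : ℝ) * (f k (ζ i).1 - f k (ζ i).2)) ∂Q =
      2 ^ m * J := by
    simp [hJ]
  have hae : ∀ᵐ ζ ∂Q, ∀ i, p (ζ i).1 ∧ p (ζ i).2 := by
    refine ae_all_iff.2 fun i => ?_
    have h2 : ∀ᵐ q ∂(𝒟.prod 𝒟), p q.1 ∧ p q.2 :=
      (Measure.quasiMeasurePreserving_fst.ae hp).and (Measure.quasiMeasurePreserving_snd.ae hp)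
    exact (Measure.quasiMeasurePreserving_eval (fun _ : Fin m => 𝒟.prod 𝒟) i).ae h2
  have hle : 2 ^ m * J ≤ 2 ^ m * W := by
    rw [← hcard, ← integral_finsetSum _ fun ε _ => hεint ε]
    calc _ ≤ ∫ _ζ : Fin m → Z × Z, 2 ^ m * W ∂Q := by
          refine integral_mono_ae (integrable_finsetSum _ fun ε _ => hεint ε)
            (integrable_const _) ?_
          filter_upwards [hae] with ζ hζ
          exact sum_signs_exp_iSup_sub_le (fun k i => f k (ζ i).1) (fun k i => f k (ζ i).2)
            (hW _ fun i => (hζ i).1) (hW _ fun i => (hζ i).2)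
      _ = _ := by simp
  exact le_of_mul_le_mul_left hle (by positivity)

end Symmetrization

/-! ### Sign sums of the loss of two-layer nets -/

/-- The loss splits into its value at prediction `0`, free of the parameters and bounded by `A`, and
a remainder that vanishes at prediction `0`, as contraction requires. Separating the two by
convexity turns `2t` into `4t`, whence `8 = 4²/2`. -/
theorem sum_signs_exp_iSup_loss_le {E : Type*} [NormedAddCommGroup E] [InnerProductSpace ℝ E]
    {ι Y : Type*} [Finite ι] [Nonempty ι] {K m : ℕ}
    (w : ι → Fin K → ℝ) (hw : ∀ k, ∑ j, |w k j| ≤ 1) (ℓ : ι → Fin K → E →ₗ[ℝ] ℝ) {R : ℝ}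
    (hR : 0 ≤ R) (hℓ : ∀ k j x, |ℓ k j x| ≤ R * ‖x‖) {γ lam : ℝ≥0} {σ : ℝ → ℝ}
    (hσ : LipschitzWith γ σ) (hσ0 : σ 0 = 0) {φ : ℝ → Y → ℝ}
    (hφ : ∀ y, LipschitzWith lam fun s => φ s y) {y₀ : Y} {A : ℝ}
    (hA : ∀ y, |φ 0 y - φ 0 y₀| ≤ A) {B : ℝ} (z : Fin m → E × Y) (hz : ∀ i, ‖(z i).1‖ ≤ B)
    {t : ℝ} (ht : 0 ≤ t) :
    ∑ ε : Fin m → ℤˣ, Real.exp (⨆ k, 2 * t * ∑ i, ((ε i : ℤ) : ℝ) *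
        (φ (∑ j, w k j * σ (ℓ k j (z i).1)) (z i).2 - φ 0 y₀)) ≤
      2 ^ m * (Real.exp (8 * m * (t * A) ^ 2) +
        2 * Real.exp (8 * m * (t * (lam * γ * R * B)) ^ 2)) := by
  let h : ι → Fin m → ℝ := fun k i => ∑ j, w k j * σ (ℓ k j (z i).1)
  let a : Fin m → ℝ := fun i => φ 0 (z i).2 - φ 0 y₀
  let ψ : ι → Fin m → ℝ := fun k i => φ (h k i) (z i).2 - φ 0 (z i).2
  have hφd : ∀ s s' y, |φ s y - φ s' y| ≤ lam * |s - s'| := fun s s' y => by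
    simpa [Real.dist_eq] using (hφ y).dist_le_mul s s'
  have h4t : 0 ≤ 4 * t := by positivity
  have h4tl : 0 ≤ 4 * t * lam := by positivity
  have hA' : ∑ ε : Fin m → ℤˣ, Real.exp (4 * t * ∑ i, ((ε i : ℤ) : ℝ) * a i) ≤
      2 ^ m * (2 * Real.exp (8 * m * (t * A) ^ 2)) := by
    refine le_trans (Finset.sum_le_sum fun ε _ => Real.exp_le_exp.2 ?_)
      ((sum_signs_exp_norm_le fun i => 4 * t * a i).trans ?_)
    · refine le_trans (le_of_eq ?_) (Real.le_norm_self _)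
      rw [Finset.mul_sum]
      exact Finset.sum_congr rfl fun i _ => by rw [smul_eq_mul]; ring
    · gcongr
      calc ∑ i, ‖4 * t * a i‖ ^ 2 / 2 ≤ ∑ _i : Fin m, (4 * t * A) ^ 2 / 2 := by
            gcongr with i
            rw [norm_mul, Real.norm_of_nonneg h4t]
            gcongr
            exact hA _
        _ = _ := by rw [Finset.sum_const, Finset.card_univ, Fintype.card_fin, nsmul_eq_mul]; ring
  have hψ' : ∑ ε : Fin m → ℤˣ, Real.exp (⨆ k, ∑ i, ((ε i : ℤ) : ℝ) * (4 * t * ψ k i)) ≤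
      2 ^ m * (4 * Real.exp (8 * m * (t * (lam * γ * R * B)) ^ 2)) := by
    have hc := sum_signs_exp_iSup_contraction (fun k i => 4 * t * ψ k i)
      (fun k i => 4 * t * lam * h k i) (fun k i => ?_) (fun k l i => ?_) 0
    · simp only [Pi.zero_apply, zero_add] at hc
      refine hc.trans ((sum_signs_exp_iSup_net_le w hw ℓ hR hℓ hσ hσ0 (fun i => (z i).1) hz
        (r := 4 * t * lam) (by positivity)).trans (le_of_eq ?_))
      congr 3
      ring
    · rw [abs_mul (4 * t), abs_mul (4 * t * lam), abs_of_nonneg h4t, abs_of_nonneg h4tl,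
        mul_assoc (4 * t)]
      gcongr
      simpa using hφd (h k i) 0 (z i).2
    · rw [← mul_sub, ← mul_sub, abs_mul (4 * t), abs_mul (4 * t * lam),
        abs_of_nonneg h4t, abs_of_nonneg h4tl, mul_assoc (4 * t)]
      gcongr
      simpa [ψ] using hφd (h k i) (h l i) (z i).2
  have key : ∀ ε : Fin m → ℤˣ, Real.exp (⨆ k, 2 * t * ∑ i, ((ε i : ℤ) : ℝ) *
        (φ (h k i) (z i).2 - φ 0 y₀)) ≤
      (Real.exp (4 * t * ∑ i, ((ε i : ℤ) : ℝ) * a i) +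
        Real.exp (⨆ k, ∑ i, ((ε i : ℤ) : ℝ) * (4 * t * ψ k i))) / 2 := by
    intro ε
    set p := 4 * t * ∑ i, ((ε i : ℤ) : ℝ) * a i
    set q := ⨆ k, ∑ i, ((ε i : ℤ) : ℝ) * (4 * t * ψ k i)
    have hle : (⨆ k, 2 * t * ∑ i, ((ε i : ℤ) : ℝ) * (φ (h k i) (z i).2 - φ 0 y₀)) ≤
        p / 2 + q / 2 := by
      refine ciSup_le fun k => ?_
      have h2 := le_iSup_of_finite (fun k => ∑ i, ((ε i : ℤ) : ℝ) * (4 * t * ψ k i)) k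
      have e : 2 * t * ∑ i, ((ε i : ℤ) : ℝ) * (φ (h k i) (z i).2 - φ 0 y₀) =
          p / 2 + (∑ i, ((ε i : ℤ) : ℝ) * (4 * t * ψ k i)) / 2 := by
        simp only [p, Finset.mul_sum, Finset.sum_div, ← Finset.sum_add_distrib]
        exact Finset.sum_congr rfl fun i _ => by simp only [a, ψ]; ring
      rw [e]
      linarith
    refine (Real.exp_le_exp.2 hle).trans ?_
    have e1 : Real.exp p = Real.exp (p / 2) ^ 2 := by rw [← Real.exp_nat_mul]; congr 1; ring
    have e2 : Real.exp q = Real.exp (q / 2) ^ 2 := by rw [← Real.exp_nat_mul]; congr 1; ring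
    rw [Real.exp_add, e1, e2]
    nlinarith [sq_nonneg (Real.exp (p / 2) - Real.exp (q / 2))]
  refine (Finset.sum_le_sum fun ε _ => key ε).trans ?_
  rw [← Finset.sum_div, Finset.sum_add_distrib]
  linarith

/-! ### Deviation bounds -/

theorem measure_exists_deviation_ge_le {ι Z : Type*} [Finite ι] [Nonempty ι] [MeasurableSpace Z]
    {m : ℕ} (hm : 0 < m) {𝒟 : Measure Z} [IsProbabilityMeasure 𝒟] {f : ι → Z → ℝ}
    (hf : ∀ k, Measurable (f k)) {c : ℝ} (hc : ∀ k z, |f k z| ≤ c) {V L ρ : ℝ} (hL : 0 ≤ L)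
    (hρ : 0 < ρ) (hV : 12 * L * V ≤ m * ρ ^ 2)
    (hmgf : ∀ t, 0 ≤ t → ∫ S, Real.exp (⨆ k, t * ∑ i, (∫ z, f k z ∂𝒟 - f k (S i)))
      ∂(Measure.pi fun _ : Fin m => 𝒟) ≤ 3 * Real.exp (m * t ^ 2 * V)) :
    (Measure.pi fun _ : Fin m => 𝒟)
      {S | ∃ k, ρ ≤ ∫ z, f k z ∂𝒟 - (1 / (m : ℝ)) * ∑ i, f k (S i)} ≤
      ENNReal.ofReal (3 * Real.exp (-(3 * L))) := by
  have hm' : (0 : ℝ) < m := Nat.cast_pos.2 hm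
  -- With this `t` the Chernoff exponent is `m t² V - t m ρ ≤ 3L - 6L`.
  set t := 6 * L / (m * ρ) with ht_def
  have ht : 0 ≤ t := by positivity
  have htm : t * m * ρ = 6 * L := by rw [ht_def]; field_simp
  have htV : m * t ^ 2 * V ≤ 3 * L := by
    have e : m * t ^ 2 * V = (12 * L * V) * (3 * L / (m * ρ ^ 2)) := by
      rw [ht_def]; field_simp; ring
    rw [e]
    calc _ ≤ (m * ρ ^ 2) * (3 * L / (m * ρ ^ 2)) := by gcongr
      _ = _ := by field_simp
  have hI : ∀ k, |∫ z, f k z ∂𝒟| ≤ c := fun k => by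
    simpa using norm_integral_le_of_norm_le_const (μ := 𝒟) (f := f k) (ae_of_all _ (hc k))
  have hint : Integrable (fun S => Real.exp (⨆ k, t * ∑ i, (∫ z, f k z ∂𝒟 - f k (S i))))
      (Measure.pi fun _ : Fin m => 𝒟) :=
    integrable_exp_iSup_mul_sum (c := c + c)
      (fun k i => measurable_const.sub ((hf k).comp (measurable_pi_apply i)))
      (fun k i S => (abs_sub _ _).trans (add_le_add (hI k) (hc _ _))) ht
  have hmarkov := mul_meas_ge_le_integral_of_nonneg
    (ae_of_all _ fun S => (Real.exp_pos _).le) hint (Real.exp (t * m * ρ))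
  have hsub : {S : Fin m → Z | ∃ k, ρ ≤ ∫ z, f k z ∂𝒟 - (1 / (m : ℝ)) * ∑ i, f k (S i)} ⊆
      {S | Real.exp (t * m * ρ) ≤
        Real.exp (⨆ k, t * ∑ i, (∫ z, f k z ∂𝒟 - f k (S i)))} := by
    rintro S ⟨k, hk⟩
    refine Real.exp_le_exp.2 (le_trans ?_
      (le_iSup_of_finite (fun k => t * ∑ i, (∫ z, f k z ∂𝒟 - f k (S i))) k))
    rw [Finset.sum_sub_distrib, Finset.sum_const, Finset.card_univ, Fintype.card_fin,
      nsmul_eq_mul, mul_assoc]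
    refine mul_le_mul_of_nonneg_left ?_ ht
    calc (m : ℝ) * ρ ≤ m * (∫ z, f k z ∂𝒟 - (1 / (m : ℝ)) * ∑ i, f k (S i)) := by gcongr
      _ = _ := by field_simp
  refine (measure_mono hsub).trans ?_
  rw [ENNReal.le_ofReal_iff_toReal_le (measure_ne_top _ _) (by positivity)]
  have h1 := hmarkov.trans (hmgf t ht)
  rw [htm] at h1
  rw [htm]
  have h2 : Real.exp (m * t ^ 2 * V) ≤ Real.exp (3 * L) := Real.exp_le_exp.2 htV
  refine le_of_mul_le_mul_left (h1.trans ?_) (Real.exp_pos (6 * L))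
  calc 3 * Real.exp (m * t ^ 2 * V) ≤ 3 * Real.exp (3 * L) := by gcongr
    _ = 3 * Real.exp (6 * L + -(3 * L)) := by congr 2; ring
    _ = _ := by rw [Real.exp_add]; ring

/-- The Chernoff step needs a positive threshold, while `η` may vanish. Testing the first `j + 1`
functions at `η + 1/(j + 1)` gives increasing events that exhaust the target, so continuity from
below replaces a union bound. -/
theorem measure_exists_nat_deviation_gt_le {Z : Type*} [MeasurableSpace Z]
    {m : ℕ} (hm : 0 < m) {𝒟 : Measure Z} [IsProbabilityMeasure 𝒟] {f : ℕ → Z → ℝ}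
    (hf : ∀ k, Measurable (f k)) {c : ℝ} (hc : ∀ k z, |f k z| ≤ c) {V L η : ℝ} (hL : 0 ≤ L)
    (hη : 0 ≤ η) (hV : 12 * L * V ≤ m * η ^ 2)
    (hmgf : ∀ (j : ℕ) (t : ℝ), 0 ≤ t →
      ∫ S, Real.exp (⨆ k : Fin (j + 1), t * ∑ i, (∫ z, f k z ∂𝒟 - f k (S i)))
      ∂(Measure.pi fun _ : Fin m => 𝒟) ≤ 3 * Real.exp (m * t ^ 2 * V)) :
    (Measure.pi fun _ : Fin m => 𝒟)
      {S | ∃ k, η < ∫ z, f k z ∂𝒟 - (1 / (m : ℝ)) * ∑ i, f k (S i)} ≤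
      ENNReal.ofReal (3 * Real.exp (-(3 * L))) := by
  let A : ℕ → Set (Fin m → Z) := fun j => {S | ∃ k : Fin (j + 1),
    η + 1 / ((j : ℝ) + 1) ≤ ∫ z, f k z ∂𝒟 - (1 / (m : ℝ)) * ∑ i, f k (S i)}
  have hA : Monotone A := by
    rintro i j hij S ⟨k, hk⟩
    refine ⟨⟨k, by omega⟩, le_trans ?_ hk⟩
    gcongr
  have hsub : {S | ∃ k, η < ∫ z, f k z ∂𝒟 - (1 / (m : ℝ)) * ∑ i, f k (S i)} ⊆ ⋃ j, A j := by
    rintro S ⟨k, hk⟩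
    obtain ⟨n, hn⟩ := exists_nat_one_div_lt (sub_pos.2 hk)
    refine Set.mem_iUnion.2 ⟨max k n, ⟨k, by omega⟩, ?_⟩
    have : 1 / (((max k n : ℕ) : ℝ) + 1) ≤ 1 / ((n : ℝ) + 1) := by
      gcongr
      exact le_max_right _ _
    linarith
  refine (measure_mono hsub).trans ?_
  rw [hA.measure_iUnion]
  refine iSup_le fun j => ?_
  refine measure_exists_deviation_ge_le (ι := Fin (j + 1)) (f := fun k => f k) hm (fun k => hf k)
    (fun k => hc k) hL (by positivity) (hV.trans ?_) (hmgf j)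
  gcongr
  exact le_add_of_nonneg_right (by positivity)

/-! ### Metrics and networks -/

theorem applyMetric_apply {D : ℕ} (M : Matrix (Fin D) (Fin D) ℝ) (x : Feat D) (j : Fin D) :
    applyMetric M x j = ∑ l, M j l * x l := by
  simp [applyMetric, Matrix.toLpLin_apply, Matrix.mulVec, dotProduct]

/-- `‖Mx‖²` is the Frobenius product of `x xᵀ` and `MᵀM`, so Cauchy-Schwarz gives `‖Mx‖² ≤ √d ‖x‖²`;
then `d ≥ 1` allows the weaker factor `d`. -/
theorem norm_applyMetric_le {D : ℕ} {M : Matrix (Fin D) (Fin D) ℝ} {d : ℝ} (hd : 1 ≤ d)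
    (hM : frobSq (M.transpose * M) ≤ d) (x : Feat D) :
    ‖applyMetric M x‖ ≤ Real.sqrt d * ‖x‖ := by
  have hd0 : 0 ≤ d := by linarith
  have e : ‖applyMetric M x‖ ^ 2 =
      ∑ p : Fin D × Fin D, (x p.1 * x p.2) * (M.transpose * M) p.1 p.2 := by
    rw [EuclideanSpace.real_norm_sq_eq]
    simp only [applyMetric_apply, sq,
      Fintype.sum_prod_type, Matrix.mul_apply, Matrix.transpose_apply, Finset.mul_sum]
    rw [Finset.sum_comm]
    refine Finset.sum_congr rfl fun k _ => ?_
    rw [Finset.sum_comm]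
    refine Finset.sum_congr rfl fun i _ => ?_
    rw [Finset.sum_mul]
    exact Finset.sum_congr rfl fun l _ => by ring
  have hx : ∑ p : Fin D × Fin D, (x p.1 * x p.2) ^ 2 = (‖x‖ ^ 2) ^ 2 := by
    rw [EuclideanSpace.real_norm_sq_eq, sq (∑ i, _), Finset.sum_mul_sum, Fintype.sum_prod_type]
    simp only [mul_pow]
  have hG : ∑ p : Fin D × Fin D, (M.transpose * M) p.1 p.2 ^ 2 = frobSq (M.transpose * M) := by
    rw [Fintype.sum_prod_type, frobSq]
  have hcs := Finset.sum_mul_sq_le_sq_mul_sq Finset.univ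
    (fun p : Fin D × Fin D => x p.1 * x p.2) fun p => (M.transpose * M) p.1 p.2
  rw [← e, hx, hG] at hcs
  have h1 : (‖applyMetric M x‖ ^ 2) ^ 2 ≤ (d * ‖x‖ ^ 2) ^ 2 := by
    calc _ ≤ (‖x‖ ^ 2) ^ 2 * d := hcs.trans (by gcongr)
      _ ≤ (‖x‖ ^ 2) ^ 2 * (d * d) := by gcongr; nlinarith
      _ = _ := by ring
  have h2 : ‖applyMetric M x‖ ^ 2 ≤ d * ‖x‖ ^ 2 :=
    le_of_sq_le_sq h1 (by positivity)
  refine le_of_sq_le_sq ?_ (by positivity)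
  rwa [mul_pow, Real.sq_sqrt hd0]

/-- The linear functional `x ↦ v · M x`. -/
noncomputable def metricFunctional {D : ℕ} (M : Matrix (Fin D) (Fin D) ℝ) (v : Fin D → ℝ) : Feat D →ₗ[ℝ] ℝ where
  toFun x := ∑ j, v j * applyMetric M x j
  map_add' x y := by
    simp only [applyMetric, map_add, PiLp.add_apply, mul_add, Finset.sum_add_distrib]
  map_smul' c x := by
    simp only [applyMetric, map_smul, PiLp.smul_apply, smul_eq_mul, Finset.mul_sum,
      RingHom.id_apply]
    exact Finset.sum_congr rfl fun j _ => by ring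

theorem abs_metricFunctional_le {D : ℕ} {M : Matrix (Fin D) (Fin D) ℝ} {d : ℝ} (hd : 1 ≤ d)
    (hM : frobSq (M.transpose * M) ≤ d) {v : Fin D → ℝ} (hv : ∑ j, |v j| ≤ 1) (x : Feat D) :
    |metricFunctional M v x| ≤ Real.sqrt d * ‖x‖ := by
  refine le_trans ?_ (norm_applyMetric_le hd hM x)
  calc _ ≤ ∑ j, |v j * applyMetric M x j| := Finset.abs_sum_le_sum_abs _ _
    _ ≤ ∑ j, |v j| * ‖applyMetric M x‖ := by
        refine Finset.sum_le_sum fun j _ => ?_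
        rw [abs_mul]
        rw [← Real.norm_eq_abs (applyMetric M x j)]
        exact mul_le_mul_of_nonneg_left (PiLp.norm_apply_le _ _) (abs_nonneg _)
    _ ≤ 1 * ‖applyMetric M x‖ := by rw [← Finset.sum_mul]; gcongr
    _ = _ := one_mul _

/-- Weighting metrics together with the weights of a two-layer net. -/
abbrev NetParam (D K : ℕ) : Type :=
  (Fin D → Fin D → ℝ) × (Fin K → ℝ) × (Fin K → Fin D → ℝ)

/-- Parameters with metric in `ℳ` and weights in the unit balls of `ℓ¹`. -/
def admissibleParams {D : ℕ} (K : ℕ) (ℳ : Set (Matrix (Fin D) (Fin D) ℝ)) : Set (NetParam D K) :=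
  {θ | Matrix.of θ.1 ∈ ℳ ∧ ∑ i, |θ.2.1 i| ≤ 1 ∧ ∀ i, ∑ j, |θ.2.2 i j| ≤ 1}

/-- The loss of the net with parameters `θ`, relative to the loss of the prediction `0` at the
label `0`. -/
noncomputable def centredLoss {D K : ℕ} (σ : ℝ → ℝ) (φ : ℝ → Fin 2 → ℝ) (θ : NetParam D K) (z : Obs D) : ℝ :=
  φ (∑ i, θ.2.1 i * σ (metricFunctional (Matrix.of θ.1) (θ.2.2 i) z.1)) z.2 - φ 0 0

/-! ### Uniform deviations of the loss over all metrics and nets -/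

section CentredLoss

variable {D K : ℕ} {γ lam : ℝ≥0} {σ : ℝ → ℝ} {φ : ℝ → Fin 2 → ℝ}

theorem continuous_centredLoss_param (hσ : IsActivation γ σ)
    (hφ : ∀ y, LipschitzWith lam (fun t => φ t y)) (z : Obs D) :
    Continuous fun θ : NetParam D K => centredLoss σ φ θ z := by
  have hσc : Continuous σ := hσ.lipschitz.continuous
  refine ((hφ z.2).continuous.comp (continuous_finsetSum _ fun i _ => ?_)).sub continuous_const
  refine Continuous.mul (by fun_prop) (hσc.comp ?_)
  simp only [metricFunctional, LinearMap.coe_mk, AddHom.coe_mk, applyMetric_apply,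
    Matrix.of_apply]
  fun_prop

theorem measurable_centredLoss (hσ : IsActivation γ σ)
    (hφ : ∀ y, LipschitzWith lam (fun t => φ t y)) (θ : NetParam D K) :
    Measurable (centredLoss σ φ θ) := by
  have hσc : Continuous σ := hσ.lipschitz.continuous
  refine measurable_from_prod_countable_left fun y => Continuous.measurable ?_
  refine ((hφ y).continuous.comp (continuous_finsetSum _ fun i _ => ?_)).sub continuous_const
  exact continuous_const.mul (hσc.comp (LinearMap.continuous_of_finiteDimensional _))

theorem abs_label_le (y : Fin 2) : |φ 0 y - φ 0 0| ≤ |φ 0 1 - φ 0 0| := by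
  fin_cases y <;> simp

/-- This crude bound serves integrability, domination and boundedness below; it does not enter the
rate. -/
theorem abs_centredLoss_le (hσ : IsActivation γ σ)
    (hφ : ∀ y, LipschitzWith lam (fun t => φ t y)) {θ : NetParam D K}
    (hθ : ∑ i, |θ.2.1 i| ≤ 1) (z : Obs D) :
    |centredLoss σ φ θ z| ≤ lam + |φ 0 1 - φ 0 0| := by
  set h := ∑ i, θ.2.1 i * σ (metricFunctional (Matrix.of θ.1) (θ.2.2 i) z.1) with h_def
  have h1 : |h| ≤ 1 := by
    refine (Finset.abs_sum_le_sum_abs _ _).trans (le_trans ?_ hθ)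
    refine Finset.sum_le_sum fun i _ => ?_
    rw [abs_mul]
    exact mul_le_of_le_one_right (abs_nonneg _) (abs_le.2 (hσ.mem_Icc _))
  have h2 : |φ h z.2 - φ 0 z.2| ≤ lam := by
    have := (hφ z.2).dist_le_mul h 0
    rw [Real.dist_eq, Real.dist_eq, sub_zero] at this
    exact this.trans (mul_le_of_le_one_right lam.2 h1)
  calc |centredLoss σ φ θ z| = |(φ h z.2 - φ 0 z.2) + (φ 0 z.2 - φ 0 0)| := by
        rw [centredLoss, ← h_def]; congr 1; ring
    _ ≤ _ := (abs_add_le _ _).trans (add_le_add h2 (abs_label_le _))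

theorem integral_exp_iSup_centredLoss_le {ι : Type*} [Finite ι] [Nonempty ι] {m : ℕ}
    (hσ : IsActivation γ σ) (hφ : ∀ y, LipschitzWith lam (fun t => φ t y)) {κ B : ℝ}
    (hκ : |φ 0 1 - φ 0 0| ≤ κ * (B * lam * γ)) {ℳ : Set (Matrix (Fin D) (Fin D) ℝ)} {d : ℝ}
    (hd : 1 ≤ d) (hℳ : ∀ M ∈ ℳ, frobSq (M.transpose * M) ≤ d) {𝒟 : Measure (Obs D)}
    [IsProbabilityMeasure 𝒟] (hB : ∀ᵐ z ∂𝒟, ‖z.1‖ ≤ B) (θ : ι → NetParam D K)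
    (hθ : ∀ k, θ k ∈ admissibleParams K ℳ) {t : ℝ} (ht : 0 ≤ t) :
    ∫ S, Real.exp (⨆ k, t * ∑ i, (∫ z, centredLoss σ φ (θ k) z ∂𝒟 - centredLoss σ φ (θ k) (S i)))
      ∂(Measure.pi fun _ : Fin m => 𝒟) ≤
      3 * Real.exp (m * t ^ 2 * (8 * (κ ^ 2 + 1) * d * (B * lam * γ) ^ 2)) := by
  refine integral_exp_iSup_deviation_le (fun k => measurable_centredLoss hσ hφ (θ k))
    (fun k => abs_centredLoss_le hσ hφ (hθ k).2.1) ht hB fun S hS => ?_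
  refine (sum_signs_exp_iSup_loss_le (fun k => (θ k).2.1) (fun k => (hθ k).2.1)
    (fun k i => metricFunctional (Matrix.of (θ k).1) ((θ k).2.2 i)) (Real.sqrt_nonneg d)
    (fun k i => abs_metricFunctional_le hd (hℳ _ (hθ k).1) ((hθ k).2.2 i)) hσ.lipschitz
    hσ.map_zero hφ (y₀ := 0) (fun y => (abs_label_le y).trans hκ) S hS ht).trans ?_
  have hc : 0 ≤ (m : ℝ) * t ^ 2 * (B * lam * γ) ^ 2 := by positivity
  have e1 : 8 * m * (t * (κ * (B * lam * γ))) ^ 2 ≤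
      m * t ^ 2 * (8 * (κ ^ 2 + 1) * d * (B * lam * γ) ^ 2) := by
    have : κ ^ 2 ≤ (κ ^ 2 + 1) * d := by nlinarith [sq_nonneg κ]
    nlinarith [mul_le_mul_of_nonneg_left this hc]
  have e2 : 8 * m * (t * (lam * γ * Real.sqrt d * B)) ^ 2 ≤
      m * t ^ 2 * (8 * (κ ^ 2 + 1) * d * (B * lam * γ) ^ 2) := by
    have h1 : (t * (lam * γ * Real.sqrt d * B)) ^ 2 = t ^ 2 * (B * lam * γ) ^ 2 * d := by
      rw [show (t * (lam * γ * Real.sqrt d * B)) ^ 2 =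
        t ^ 2 * (B * lam * γ) ^ 2 * Real.sqrt d ^ 2 by ring, Real.sq_sqrt (by linarith)]
    rw [h1]
    have : d ≤ (κ ^ 2 + 1) * d := by nlinarith [sq_nonneg κ]
    nlinarith [mul_le_mul_of_nonneg_left this hc]
  have x1 := Real.exp_le_exp.2 e1
  have x2 := Real.exp_le_exp.2 e2
  gcongr
  linarith

theorem continuous_deviation_param {m : ℕ} (hσ : IsActivation γ σ)
    (hφ : ∀ y, LipschitzWith lam (fun t => φ t y)) {ℳ : Set (Matrix (Fin D) (Fin D) ℝ)}
    {𝒟 : Measure (Obs D)} [IsProbabilityMeasure 𝒟] (S : Fin m → Obs D) :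
    Continuous fun θ : admissibleParams K ℳ => ∫ z, centredLoss σ φ θ.1 z ∂𝒟 -
      (1 / (m : ℝ)) * ∑ i, centredLoss σ φ θ.1 (S i) := by
  refine Continuous.sub ?_ (continuous_const.mul (continuous_finsetSum _ fun i _ =>
    (continuous_centredLoss_param hσ hφ (S i)).comp continuous_subtype_val))
  exact continuous_of_dominated
    (fun θ => (measurable_centredLoss hσ hφ θ.1).aestronglyMeasurable)
    (fun θ => ae_of_all _ fun z => abs_centredLoss_le hσ hφ θ.2.2.1 z) (integrable_const _)
    (ae_of_all _ fun z => (continuous_centredLoss_param hσ hφ z).comp continuous_subtype_val)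

/-- The parameters whose deviation exceeds `η` form an open set, so if it is nonempty it meets a
fixed dense sequence. -/
theorem measure_exists_centredLoss_deviation_gt_le {m : ℕ} (hm : 0 < m)
    (hσ : IsActivation γ σ) (hφ : ∀ y, LipschitzWith lam (fun t => φ t y)) {κ B : ℝ}
    (hκ : |φ 0 1 - φ 0 0| ≤ κ * (B * lam * γ)) {ℳ : Set (Matrix (Fin D) (Fin D) ℝ)} {d : ℝ}
    (hd : 1 ≤ d) (hℳ : ∀ M ∈ ℳ, frobSq (M.transpose * M) ≤ d) {𝒟 : Measure (Obs D)}
    [IsProbabilityMeasure 𝒟] (hB : ∀ᵐ z ∂𝒟, ‖z.1‖ ≤ B) {L η : ℝ} (hL : 0 ≤ L) (hη : 0 ≤ η)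
    (hV : 12 * L * (8 * (κ ^ 2 + 1) * d * (B * lam * γ) ^ 2) ≤ m * η ^ 2) :
    (Measure.pi fun _ : Fin m => 𝒟)
      {S | ∃ θ ∈ admissibleParams K ℳ, η < ∫ z, centredLoss σ φ θ z ∂𝒟 -
        (1 / (m : ℝ)) * ∑ i, centredLoss σ φ θ (S i)} ≤
      ENNReal.ofReal (3 * Real.exp (-(3 * L))) := by
  rcases (admissibleParams K ℳ).eq_empty_or_nonempty with h | h
  · simp [h]
  have : Nonempty (admissibleParams K ℳ) := h.to_subtype
  let q : ℕ → admissibleParams K ℳ := TopologicalSpace.denseSeq _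
  refine le_trans (measure_mono ?_) (measure_exists_nat_deviation_gt_le hm
    (f := fun k => centredLoss σ φ (q k).1) (fun k => measurable_centredLoss hσ hφ (q k).1)
    (fun k => abs_centredLoss_le hσ hφ (q k).2.2.1) hL hη hV fun j t ht =>
      integral_exp_iSup_centredLoss_le hσ hφ hκ hd hℳ hB (fun k : Fin (j + 1) => (q k).1)
        (fun k => (q k).2) ht)
  rintro S ⟨θ, hθ, hlt⟩
  obtain ⟨k, hk⟩ := (TopologicalSpace.denseRange_denseSeq (admissibleParams K ℳ)).exists_mem_open
    (isOpen_lt continuous_const (continuous_deviation_param hσ hφ (𝒟 := 𝒟) S)) ⟨⟨θ, hθ⟩, hlt⟩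
  exact ⟨k, hk⟩

theorem errHyp_sub_errHypEmp_le {m : ℕ} (hm : 0 < m)
    (hσ : IsActivation γ σ) (hφ : ∀ y, LipschitzWith lam (fun t => φ t y))
    {ℳ : Set (Matrix (Fin D) (Fin D) ℝ)} {𝒟 : Measure (Obs D)} [IsProbabilityMeasure 𝒟] {η : ℝ}
    {S : Fin m → Obs D}
    (hS : ∀ θ ∈ admissibleParams K ℳ, ∫ z, centredLoss σ φ θ z ∂𝒟 -
        (1 / (m : ℝ)) * ∑ i, centredLoss σ φ θ (S i) ≤ η)
    {M : Matrix (Fin D) (Fin D) ℝ} (hM : M ∈ ℳ) :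
    errHyp (twoLayerNets D K σ) φ M 𝒟 - errHypEmp (twoLayerNets D K σ) φ M S ≤ η := by
  have hm' : (m : ℝ) ≠ 0 := Nat.cast_ne_zero.2 hm.ne'
  have hne : Nonempty (twoLayerNets D K σ) :=
    ⟨⟨fun _ => 0, 0, 0, by simp, by simp, by simp⟩⟩
  have hrep : ∀ h : twoLayerNets D K σ, ∃ θ ∈ admissibleParams K ℳ,
      ∀ z : Obs D, φ (h.1 (applyMetric M z.1)) z.2 = centredLoss σ φ θ z + φ 0 0 := by
    rintro ⟨h, w, v, hw, hv, hh⟩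
    refine ⟨(M, w, v), ⟨hM, hw, hv⟩, fun z => ?_⟩
    simp only [hh, centredLoss, sub_add_cancel]
    rfl
  -- Without a lower bound the real infimum would take its default value.
  have hbdd : BddBelow (Set.range fun h : twoLayerNets D K σ =>
      ∫ z, φ (h.1 (applyMetric M z.1)) z.2 ∂𝒟) := by
    refine ⟨-(lam + |φ 0 1 - φ 0 0|) + φ 0 0, ?_⟩
    rintro _ ⟨h, rfl⟩
    obtain ⟨θ, hθ, hz⟩ := hrep h
    have hi : Integrable (centredLoss σ φ θ) 𝒟 :=
      Integrable.of_bound (measurable_centredLoss hσ hφ θ).aestronglyMeasurable _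
        (ae_of_all _ (abs_centredLoss_le hσ hφ hθ.2.1))
    simp only [hz]
    calc -(lam + |φ 0 1 - φ 0 0|) + φ 0 0 =
          ∫ _z : Obs D, (-(lam + |φ 0 1 - φ 0 0|) + φ 0 0) ∂𝒟 := by simp
      _ ≤ _ := integral_mono (integrable_const _) (hi.add (integrable_const _)) fun z => by
          simpa using (abs_le.1 (abs_centredLoss_le hσ hφ hθ.2.1 z)).1
  rw [sub_le_comm]
  refine le_ciInf fun h => ?_
  obtain ⟨θ, hθ, hz⟩ := hrep h
  have hi : Integrable (centredLoss σ φ θ) 𝒟 :=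
    Integrable.of_bound (measurable_centredLoss hσ hφ θ).aestronglyMeasurable _
      (ae_of_all _ (abs_centredLoss_le hσ hφ hθ.2.1))
  have h1 : errHyp (twoLayerNets D K σ) φ M 𝒟 ≤ ∫ z, centredLoss σ φ θ z ∂𝒟 + φ 0 0 := by
    refine (ciInf_le hbdd h).trans (le_of_eq ?_)
    simp only [hz]
    rw [integral_add hi (integrable_const _)]
    simp
  have h2 : (1 / (m : ℝ)) * ∑ i, φ (h.1 (applyMetric M (S i).1)) (S i).2 =
      (1 / (m : ℝ)) * ∑ i, centredLoss σ φ θ (S i) + φ 0 0 := by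
    simp only [hz, Finset.sum_add_distrib, Finset.sum_const, Finset.card_univ, Fintype.card_fin,
      nsmul_eq_mul]
    field_simp
  rw [h2]
  linarith [hS θ hθ]

end CentredLoss

/-- The left side is `3 (δ/D)³`, and `δ/D ≤ 1/2` leaves at most `3δ/4`. This ratio bound is
automatic for `D ≥ 2` and is the extra assumption for `D = 1`. -/
theorem three_mul_exp_neg_log_le {D : ℕ} (hD : 1 ≤ D) {δ : ℝ} (hδ : 0 < δ) (hδ1 : δ < 1)
    (hD1 : D = 1 → δ ≤ 1 / 2) : 3 * Real.exp (-(3 * Real.log (D / δ))) ≤ δ := by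
  have hD' : (1 : ℝ) ≤ D := by exact_mod_cast hD
  have hpos : 0 < (D : ℝ) / δ := by positivity
  have e : Real.exp (-(3 * Real.log (D / δ))) = (δ / D) ^ 3 := by
    rw [Real.exp_neg, show (3 : ℝ) * Real.log (D / δ) = ((3 : ℕ) : ℝ) * Real.log (D / δ) by simp,
      Real.exp_nat_mul, Real.exp_log hpos, ← inv_pow, inv_div]
  have h1 : δ / D ≤ δ := div_le_self hδ.le hD'
  have h2 : δ / D ≤ 1 / 2 := by
    rcases hD.eq_or_lt with h | h
    · exact h1.trans (hD1 h.symm)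
    · have : (2 : ℝ) ≤ D := by exact_mod_cast h
      rw [div_le_iff₀ (by positivity)]
      linarith
  have h0 : 0 ≤ δ / D := by positivity
  rw [e]
  have h3 : (δ / D) ^ 2 ≤ (1 / 2) ^ 2 := by gcongr
  calc 3 * (δ / D) ^ 3 = 3 * (δ / D) ^ 2 * (δ / D) := by ring
    _ ≤ 3 * (1 / 2) ^ 2 * δ := by gcongr
    _ ≤ δ := by linarith

theorem lemma6 (κ : ℝ) :
    ∃ C : ℝ, 0 < C ∧
      ∀ (D K m : ℕ), 1 ≤ D → 1 ≤ m →
      ∀ (γ lam : ℝ≥0), 0 < γ →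
      ∀ (σ : ℝ → ℝ), IsActivation γ σ →
      ∀ (B : ℝ) (φ : ℝ → Fin 2 → ℝ), (∀ y, LipschitzWith lam (fun t => φ t y)) →
        |φ 0 1 - φ 0 0| ≤ κ * (B * lam * γ) →
      ∀ (ℳ : Set (Matrix (Fin D) (Fin D) ℝ)) (d : ℝ), 1 ≤ d →
        (∀ M ∈ ℳ, frobSq (M.transpose * M) ≤ d) →
      ∀ (𝒟 : Measure (Obs D)), IsProbabilityMeasure 𝒟 → (∀ᵐ z ∂𝒟, ‖z.1‖ ≤ B) →
      ∀ (δ : ℝ), 0 < δ → δ < 1 → (D = 1 → δ ≤ 1 / 2) →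
        ENNReal.ofReal (1 - δ) ≤
          Measure.pi (fun _ : Fin m => 𝒟)
            {S | ∀ M ∈ ℳ,
              errHyp (twoLayerNets D K σ) φ M 𝒟 - errHypEmp (twoLayerNets D K σ) φ M S ≤
                C * (B * lam * γ * Real.sqrt (d * Real.log (D / δ) / m))} := by
  -- Here `96 = 12 · 8`: 12 from the Chernoff condition and 8 from the moment bound, which makes
  -- that condition an equality.
  refine ⟨Real.sqrt (96 * (κ ^ 2 + 1)), by positivity, ?_⟩
  intro D K m hD hm γ lam _ σ hσ B φ hφ hκ ℳ d hd hℳ 𝒟 _ hB δ hδ hδ1 hD1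
  have hm' : (0 : ℝ) < m := Nat.cast_pos.2 hm
  have hD' : (1 : ℝ) ≤ D := by exact_mod_cast hD
  have hB0 : 0 ≤ B := by
    obtain ⟨z, hz⟩ := hB.exists
    exact (norm_nonneg _).trans hz
  set L := Real.log (D / δ)
  have hL : 0 ≤ L := Real.log_nonneg ((one_le_div hδ).2 (hδ1.le.trans hD'))
  set η := Real.sqrt (96 * (κ ^ 2 + 1)) * (B * lam * γ * Real.sqrt (d * L / m))
  have hη : 0 ≤ η := by positivity
  have hηsq : m * η ^ 2 = 12 * L * (8 * (κ ^ 2 + 1) * d * (B * lam * γ) ^ 2) := by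
    rw [mul_pow, mul_pow, Real.sq_sqrt (by positivity), Real.sq_sqrt (by positivity)]
    field_simp
    ring
  have hbad := measure_exists_centredLoss_deviation_gt_le (K := K) hm hσ hφ hκ hd hℳ hB hL hη
    hηsq.ge
  set bad := {S : Fin m → Obs D | ∃ θ ∈ admissibleParams K ℳ, η < ∫ z, centredLoss σ φ θ z ∂𝒟 -
        (1 / (m : ℝ)) * ∑ i, centredLoss σ φ θ (S i)}
  have hsub : badᶜ ⊆ {S | ∀ M ∈ ℳ,
      errHyp (twoLayerNets D K σ) φ M 𝒟 - errHypEmp (twoLayerNets D K σ) φ M S ≤ η} := by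
    intro S hS M hM
    refine errHyp_sub_errHypEmp_le hm hσ hφ (fun θ hθ => ?_) hM
    by_contra hlt
    exact hS ⟨θ, hθ, not_le.1 hlt⟩
  refine le_trans ?_ (measure_mono hsub)
  have hδbad : (Measure.pi fun _ : Fin m => 𝒟) bad ≤ ENNReal.ofReal δ :=
    hbad.trans (ENNReal.ofReal_le_ofReal (three_mul_exp_neg_log_le hD hδ hδ1 hD1))
  rw [ENNReal.ofReal_sub _ hδ.le, ENNReal.ofReal_one, tsub_le_iff_left]
  -- Subadditivity suffices, so `bad` need not be measurable.
  calc (1 : ENNReal) = (Measure.pi fun _ : Fin m => 𝒟) Set.univ := measure_univ.symm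
    _ ≤ (Measure.pi fun _ : Fin m => 𝒟) bad + (Measure.pi fun _ : Fin m => 𝒟) badᶜ := by
        rw [← Set.union_compl_self bad]; exact measure_union_le _ _
    _ ≤ _ := by gcongr
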